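/- Let $\mathcal C$ be a symmetric monoidal category with unit $I$. Write $c_1\otimes\cdots\otimes c_k$ for the left-bracketed product $((c_1\otimes c_2)\otimes\cdots)\otimes c_k$ (it is $I$ for $k=0$ and $c_1$ for $k=1$), and $c^{\otimes m}$ for its value on $m$ copies of $c$. Let $\sigma$ denote the canonical symmetry isomorphisms $c_1^{\otimes m}\otimes\cdots\otimes c_k^{\otimes m}\cong(c_1\otimes\cdots\otimes c_k)^{\otimes m}$, in particular $c^{\otimes m}\otimes d^{\otimes m}\cong(c\otimes d)^{\otimes m}$ and $I\cong I^{\otimes m}$. A *prop* $\mathbb P$ is a symmetric strict monoidal category whose monoid of objects is $(\mathbb N,0,+)$. A *supply* $s$ of $\mathbb P$ in $\mathcal C$ consists of a strong symmetric monoidal functor $s_c\colon\mathbb P\to\mathcal C$ for each object $c$ of $\mathcal C$ such that (i) $s_c(m)=c^{\otimes m}$; (ii) the strongator $c^{\otimes m}\otimes c^{\otimes n}\to c^{\otimes(m+n)}$ is the coherence isomorphism; (iii) for all $c,d$ and $\mu\colon m\to n$ in $\mathbb P$, in diagrammatic order, $(s_c(\mu)\otimes s_d(\mu))\,;\,\sigma=\sigma\,;\,s_{c\otimes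 d}(\mu)$ and $\sigma=\sigma\,;\,s_I(\mu)$ (as maps $I\to I^{\otimes n}$). Given supplies $s$ of $\mathbb P$ in $\mathcal C$ and $t$ of $\mathbb P$ in $\mathcal D$, a strong symmetric monoidal functor $F\colon\mathcal C\to\mathcal D$ *preserves the supply* if for each object $c$ of $\mathcal C$ the strongators $F(c)^{\otimes m}\cong F(c^{\otimes m})$ of $F$ form a natural isomorphism from $t_{F(c)}$ to $F\circ s_c$ of functors $\mathbb P\to\mathcal D$. The *strictification* $\overline{\mathcal C}$ of $\mathcal C$ has as objects the finite lists of objects of $\mathcal C$, as morphisms $[c_1,\dots,c_k]\to[d_1,\dots,d_l]$ the morphisms $c_1\otimes\cdots\otimes c_k\to d_1\otimes\cdots\otimes d_l$ of $\mathcal C$, concatenation as strict monoidal product on objects, and the product of morphisms and the braiding of $\mathcal C$ transported along the coherence isomorphisms. The functor $\bigotimes\colon\overline{\mathcal C}\to\mathcal C$, $[c_1,\dots,c_k]\mapsto c_1\otimes\cdots\otimes c_k$, is a strong symmetric monoidal equivalence. Let $s$ be a supply of $\mathbb P$ in $\mathcal C$. Then there is a supply $\overline s$ of $\mathbb P$ in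 $\overline{\mathcal C}$, the *induced supply*, given for $L=[c_1,\dots,c_k]$ and $\mu\colon m\to n$ by $$\overline s_L(\mu)=\sigma^{-1}\,;\,\bigl(s_{[c_1]}(\mu)\otimes\cdots\otimes s_{[c_k]}(\mu)\bigr)\,;\,\sigma\ \colon\ L^{\otimes m}\to L^{\otimes n},$$ where the products and the $\sigma$'s are those of $\overline{\mathcal C}$ and $s_{[c]}(\mu)\colon[c]^{\otimes m}\to[c]^{\otimes n}$ is the morphism of $\overline{\mathcal C}$ that $\bigotimes$ sends to $s_c(\mu)\colon c^{\otimes m}\to c^{\otimes n}$. Moreover, the equivalence $\bigotimes\colon\overline{\mathcal C}\to\mathcal C$ preserves the supply, with respect to $\overline s$ in $\overline{\mathcal C}$ and $s$ in $\mathcal C$. -/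

import Mathlib

open CategoryTheory MonoidalCategory

universe v v₁ v₂ u u₁ u₂

/-- Finite lists `[x₁, …, xₖ]`, built up by adding entries on the right. -/
inductive Word (ι : Type u) : Type u
  | nil : Word ι
  | snoc : Word ι → ι → Word ι

namespace Word

/-- The one-entry list `[x]`. -/
def single {ι : Type u} (x : ι) : Word ι := snoc nil x

/-- Concatenation of lists. -/
def append {ι : Type u} (w : Word ι) : Word ι → Word ι
  | nil => w
  | snoc w' x => snoc (append w w') x

theorem nil_append {ι : Type u} : ∀ w : Word ι, append nil w = w
  | nil => rfl
  | snoc w x => congrArg (fun z => snoc z x) (nil_append w)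

theorem append_assoc {ι : Type u} (w₁ w₂ : Word ι) :
    ∀ w₃ : Word ι, append (append w₁ w₂) w₃ = append w₁ (append w₂ w₃)
  | nil => rfl
  | snoc w x => congrArg (fun z => snoc z x) (append_assoc w₁ w₂ w)

/-- Apply a function to every entry. -/
def map {ι : Type u₁} {κ : Type u₂} (f : ι → κ) : Word ι → Word κ
  | nil => nil
  | snoc w x => snoc (map f w) (f x)

/-- The list `[x, …, x]` with `n` entries. -/
def replicate {ι : Type u} (x : ι) : ℕ → Word ι
  | 0 => nil
  | n + 1 => snoc (replicate x n) x

end Word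

/-! ### Iterated monoidal products and canonical isomorphisms -/

section Monoidal

variable {C : Type u₁} [Category.{v₁} C] [MonoidalCategory C]

/-- The left-bracketed product `((c₁ ⊗ c₂) ⊗ ⋯) ⊗ cₖ`; it is `𝟙_ C` for the empty list, and `c`
for the one-entry list `[c]`. -/
def Word.tensor : Word C → C
  | .nil => 𝟙_ C
  | .snoc .nil c => c
  | .snoc (.snoc w d) c => Word.tensor (.snoc w d) ⊗ c

/-- The canonical isomorphism `(c₁ ⊗ ⋯ ⊗ cₖ) ⊗ c ≅ c₁ ⊗ ⋯ ⊗ cₖ ⊗ c`: an identity if `k > 0`, and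
the left unitor if `k = 0`. -/
def Word.snocIso : ∀ (w : Word C) (c : C), w.tensor ⊗ c ≅ (Word.snoc w c).tensor
  | .nil, c => λ_ c
  | .snoc w d, c => Iso.refl ((Word.snoc w d).tensor ⊗ c)

/-- The canonical isomorphism
`(c₁ ⊗ ⋯ ⊗ cₖ) ⊗ (d₁ ⊗ ⋯ ⊗ dₗ) ≅ c₁ ⊗ ⋯ ⊗ cₖ ⊗ d₁ ⊗ ⋯ ⊗ dₗ`, composed of associators and
unitors. -/
def Word.appendIso (w : Word C) : ∀ w' : Word C, w.tensor ⊗ w'.tensor ≅ (w.append w').tensor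
  | .nil => ρ_ w.tensor
  | .snoc w' c =>
      whiskerLeftIso w.tensor (Word.snocIso w' c).symm ≪≫
        (α_ w.tensor w'.tensor c).symm ≪≫
        whiskerRightIso (Word.appendIso w w') c ≪≫ Word.snocIso (w.append w') c

/-- The product `f_{i₁} ⊗ ⋯ ⊗ f_{iₖ}` of the morphisms `fᵢ : X i ⟶ Y i`, along a list
`[i₁, …, iₖ]`. -/
def Word.tensorMap {ι : Type u} {X Y : ι → C} (f : ∀ i, X i ⟶ Y i) :
    ∀ w : Word ι, (w.map X).tensor ⟶ (w.map Y).tensor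
  | .nil => 𝟙 (𝟙_ C)
  | .snoc w i =>
      (Word.snocIso (w.map X) (X i)).inv ≫ (Word.tensorMap f w ⊗ₘ f i) ≫
        (Word.snocIso (w.map Y) (Y i)).hom

/-- The tensor power `c^{⊗n} = ((c ⊗ c) ⊗ ⋯) ⊗ c`. -/
def tpow (c : C) (n : ℕ) : C := (Word.replicate c n).tensor

/-- The canonical isomorphism `c^{⊗n} ⊗ c ≅ c^{⊗(n+1)}`. -/
def tpowSucc (c : C) (n : ℕ) : tpow c n ⊗ c ≅ tpow c (n + 1) :=
  Word.snocIso (Word.replicate c n) c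

/-- The tensor power `f^{⊗n} : c^{⊗n} ≅ d^{⊗n}` of an isomorphism. -/
def tpowMapIso {c d : C} (f : c ≅ d) : ∀ n : ℕ, tpow c n ≅ tpow d n
  | 0 => Iso.refl (𝟙_ C)
  | n + 1 => (tpowSucc c n).symm ≪≫ (tpowMapIso f n ⊗ᵢ f) ≪≫ tpowSucc d n

/-- The coherence isomorphism `c^{⊗m} ⊗ c^{⊗n} ≅ c^{⊗(m+n)}`, composed of associators and
unitors. -/
def tpowAdd (c : C) (m : ℕ) : ∀ n : ℕ, tpow c m ⊗ tpow c n ≅ tpow c (m + n)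
  | 0 => ρ_ (tpow c m)
  | n + 1 =>
      whiskerLeftIso (tpow c m) (tpowSucc c n).symm ≪≫
        (α_ (tpow c m) (tpow c n) c).symm ≪≫
        whiskerRightIso (tpowAdd c m n) c ≪≫ tpowSucc c (m + n)

/-- The canonical isomorphism `σ : I ≅ I^{⊗n}`. -/
def sigmaUnit : ∀ n : ℕ, 𝟙_ C ≅ tpow (𝟙_ C) n
  | 0 => Iso.refl (𝟙_ C)
  | n + 1 =>
      (λ_ (𝟙_ C)).symm ≪≫ whiskerRightIso (sigmaUnit n) (𝟙_ C) ≪≫ tpowSucc (𝟙_ C) n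

end Monoidal

section Symmetric

variable {C : Type u₁} [Category.{v₁} C] [MonoidalCategory C] [SymmetricCategory C]

/-- The middle-four interchange `(a ⊗ b) ⊗ (c ⊗ d) ≅ (a ⊗ c) ⊗ (b ⊗ d)`. -/
def interchangeIso (a b c d : C) : (a ⊗ b) ⊗ (c ⊗ d) ≅ (a ⊗ c) ⊗ (b ⊗ d) where
  hom := tensorμ a b c d
  inv := tensorδ a b c d
  hom_inv_id := tensorμ_tensorδ a b c d
  inv_hom_id := tensorδ_tensorμ a b c d

/-- The symmetry isomorphism `σ : c^{⊗n} ⊗ d^{⊗n} ≅ (c ⊗ d)^{⊗n}`. -/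
def sigmaPair (c d : C) : ∀ n : ℕ, tpow c n ⊗ tpow d n ≅ tpow (c ⊗ d) n
  | 0 => λ_ (𝟙_ C)
  | n + 1 =>
      ((tpowSucc c n).symm ⊗ᵢ (tpowSucc d n).symm) ≪≫
        interchangeIso (tpow c n) c (tpow d n) d ≪≫
        whiskerRightIso (sigmaPair c d n) (c ⊗ d) ≪≫ tpowSucc (c ⊗ d) n

/-- The symmetry isomorphism
`σ : X_{i₁}^{⊗n} ⊗ ⋯ ⊗ X_{iₖ}^{⊗n} ≅ (X_{i₁} ⊗ ⋯ ⊗ X_{iₖ})^{⊗n}`. -/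
def sigmaWord {ι : Type u} (X : ι → C) (n : ℕ) :
    ∀ w : Word ι, (w.map fun i => tpow (X i) n).tensor ≅ tpow (w.map X).tensor n
  | .nil => sigmaUnit n
  | .snoc w i =>
      (Word.snocIso (w.map fun i => tpow (X i) n) (tpow (X i) n)).symm ≪≫
        whiskerRightIso (sigmaWord X n w) (tpow (X i) n) ≪≫
        sigmaPair (w.map X).tensor (X i) n ≪≫
        tpowMapIso (Word.snocIso (w.map X) (X i)) n

end Symmetric

/-- The strongator `φ : F(c)^{⊗n} ≅ F(c^{⊗n})` of a strong monoidal functor, composed of the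
strongators `I ≅ F(I)` and `F(c) ⊗ F(c') ≅ F(c ⊗ c')`. -/
def tpowStrongator {C : Type u₁} [Category.{v₁} C] [MonoidalCategory C]
    {D : Type u₂} [Category.{v₂} D] [MonoidalCategory D] (F : C ⥤ D) [F.Monoidal] (c : C) :
    ∀ n : ℕ, tpow (F.obj c) n ≅ F.obj (tpow c n)
  | 0 => Functor.Monoidal.εIso F
  | n + 1 =>
      (tpowSucc (F.obj c) n).symm ≪≫ whiskerRightIso (tpowStrongator F c n) (F.obj c) ≪≫
        Functor.Monoidal.μIso F (tpow c n) c ≪≫ F.mapIso (tpowSucc c n)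

/-! ### Props -/

/-- A monoidal category is strict if its product is strictly associative and unital, and its
associators and unitors are identities. -/
class IsStrictMonoidal (C : Type u₁) [Category.{v₁} C] [MonoidalCategory C] : Prop where
  tensor_assoc : ∀ X Y Z : C, (X ⊗ Y) ⊗ Z = X ⊗ (Y ⊗ Z)
  unit_tensor : ∀ X : C, 𝟙_ C ⊗ X = X
  tensor_unit : ∀ X : C, X ⊗ 𝟙_ C = X
  associator_eq : ∀ X Y Z : C, (α_ X Y Z).hom = eqToHom (tensor_assoc X Y Z)
  leftUnitor_eq : ∀ X : C, (λ_ X).hom = eqToHom (unit_tensor X)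
  rightUnitor_eq : ∀ X : C, (ρ_ X).hom = eqToHom (tensor_unit X)

/-- A prop: a symmetric strict monoidal category whose monoid of objects is `(ℕ, 0, +)`. The
identification of the objects with the natural numbers is `size` (it is unique, as `ℕ` has no
nontrivial monoid automorphism). -/
class PROP (P : Type u) [Category.{v} P] [MonoidalCategory P] [SymmetricCategory P]
    extends IsStrictMonoidal P where
  size : P ≃ ℕ
  size_unit : size (𝟙_ P) = 0
  size_tensor : ∀ p q : P, size (p ⊗ q) = size p + size q

/-! ### Supply -/

/-- A supply of the prop `P` in the symmetric monoidal category `C`. -/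
structure Supply (P : Type u) [Category.{v} P] [MonoidalCategory P] [SymmetricCategory P] [PROP P]
    (C : Type u₁) [Category.{v₁} C] [MonoidalCategory C] [SymmetricCategory C] where
  /-- the functors `s_c : P ⥤ C` -/
  functor : C → P ⥤ C
  /-- each `s_c` is a strong symmetric monoidal functor -/
  braided : ∀ c, (functor c).Braided
  /-- `s_c(m) = c^{⊗m}` -/
  obj_eq : ∀ (c : C) (p : P), (functor c).obj p = tpow c (PROP.size p)
  /-- the strongator `c^{⊗m} ⊗ c^{⊗n} ⟶ c^{⊗(m+n)}` of `s_c` is the coherence isomorphism -/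
  strongator_eq : ∀ (c : C) (p q : P),
    Functor.LaxMonoidal.μ (functor c) p q =
      (eqToHom (obj_eq c p) ⊗ₘ eqToHom (obj_eq c q)) ≫
        (tpowAdd c (PROP.size p) (PROP.size q)).hom ≫
        eqToHom (by rw [obj_eq, PROP.size_tensor])
  /-- the square relating `s_c(μ) ⊗ s_d(μ)` to `s_{c ⊗ d}(μ)` through `σ` -/
  map_tensor : ∀ (c d : C) {p q : P} (μ : p ⟶ q),
    ((eqToHom (obj_eq c p).symm ≫ (functor c).map μ ≫ eqToHom (obj_eq c q)) ⊗ₘ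
        (eqToHom (obj_eq d p).symm ≫ (functor d).map μ ≫ eqToHom (obj_eq d q))) ≫
        (sigmaPair c d (PROP.size q)).hom =
      (sigmaPair c d (PROP.size p)).hom ≫
        (eqToHom (obj_eq (c ⊗ d) p).symm ≫ (functor (c ⊗ d)).map μ ≫ eqToHom (obj_eq (c ⊗ d) q))
  /-- the triangle relating `s_I(μ)` to the identity of `I` through `σ` -/
  map_unit : ∀ {p q : P} (μ : p ⟶ q),
    (sigmaUnit (PROP.size q)).hom =
      (sigmaUnit (PROP.size p)).hom ≫
        (eqToHom (obj_eq (𝟙_ C) p).symm ≫ (functor (𝟙_ C)).map μ ≫ eqToHom (obj_eq (𝟙_ C) q))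

/-- The morphism `s_c(μ) : c^{⊗m} ⟶ c^{⊗n}` supplied for `μ : m ⟶ n`. -/
def Supply.map {P : Type u} [Category.{v} P] [MonoidalCategory P] [SymmetricCategory P] [PROP P]
    {C : Type u₁} [Category.{v₁} C] [MonoidalCategory C] [SymmetricCategory C]
    (s : Supply P C) (c : C) {p q : P} (μ : p ⟶ q) :
    tpow c (PROP.size p) ⟶ tpow c (PROP.size q) :=
  eqToHom (s.obj_eq c p).symm ≫ (s.functor c).map μ ≫ eqToHom (s.obj_eq c q)

/-- A strong symmetric monoidal functor `F : C ⥤ D` preserves the supplies `s` in `C` and `t` in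
`D` if for each `c` its strongators `F(c)^{⊗m} ≅ F(c^{⊗m})` are the components of a natural
isomorphism `t_{F(c)} ≅ s_c ⋙ F` of functors `P ⥤ D`. -/
def PreservesSupply {P : Type u} [Category.{v} P] [MonoidalCategory P] [SymmetricCategory P]
    [PROP P] {C : Type u₁} [Category.{v₁} C] [MonoidalCategory C] [SymmetricCategory C]
    {D : Type u₂} [Category.{v₂} D] [MonoidalCategory D] [SymmetricCategory D]
    (F : C ⥤ D) [F.Braided] (s : Supply P C) (t : Supply P D) : Prop :=
  ∀ c : C, ∃ φ : t.functor (F.obj c) ≅ s.functor c ⋙ F, ∀ p : P,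
    φ.hom.app p =
      eqToHom (t.obj_eq (F.obj c) p) ≫ (tpowStrongator F c (PROP.size p)).hom ≫
        F.map (eqToHom (s.obj_eq c p).symm)

/-! ### Strictification -/

section Strictification

variable (C : Type u₁) [Category.{v₁} C] [MonoidalCategory C]

/-- Mac Lane's strictification of `C`: the objects are the finite lists of objects of `C`, and the
morphisms `[c₁, …, cₖ] ⟶ [d₁, …, dₗ]` are the morphisms `c₁ ⊗ ⋯ ⊗ cₖ ⟶ d₁ ⊗ ⋯ ⊗ dₗ` of `C`. -/
def Strictification : Type u₁ := InducedCategory C (Word.tensor (C := C))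

instance : Category.{v₁} (Strictification C) :=
  inferInstanceAs (Category (InducedCategory C (Word.tensor (C := C))))

/-- The functor `⨂` from the strictification to `C`, sending `[c₁, …, cₖ]` to `c₁ ⊗ ⋯ ⊗ cₖ`. -/
def bigTensor : Strictification C ⥤ C := inducedFunctor (Word.tensor (C := C))

instance : (bigTensor C).Full := InducedCategory.full _

instance : (bigTensor C).Faithful := InducedCategory.faithful _

instance : (bigTensor C).EssSurj where
  mem_essImage c := ⟨Word.single c, ⟨Iso.refl c⟩⟩

instance : (bigTensor C).IsEquivalence where

variable {C}

/-- The object of the strictification given by a list. -/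
def Strictification.of (w : Word C) : Strictification C := w

/-- The list underlying an object of the strictification. -/
def Strictification.word (X : Strictification C) : Word C := X

/-- The morphism of the strictification given by a morphism of `C`. -/
def Strictification.homMk {X Y : Strictification C} (f : X.word.tensor ⟶ Y.word.tensor) : X ⟶ Y :=
  InducedCategory.homMk f

/-- The canonical isomorphism `⨂ X ⊗ ⨂ Y ≅ ⨂ (X · Y)`, where `X · Y` is the concatenation. -/
def bigTensorμIso (X Y : Strictification C) :
    (bigTensor C).obj X ⊗ (bigTensor C).obj Y ≅
      (bigTensor C).obj (Strictification.of (X.word.append Y.word)) :=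
  Word.appendIso X.word Y.word

/-- The monoidal product of the strictification is concatenation of lists, its unit is the empty
list, its associators and unitors are identities, and the product of morphisms is that of `C`. -/
instance : MonoidalCategoryStruct (Strictification C) where
  tensorObj X Y := Strictification.of (X.word.append Y.word)
  tensorUnit := Strictification.of Word.nil
  whiskerLeft X _ _ f := Strictification.homMk
    ((bigTensorμIso _ _).inv ≫ ((bigTensor C).obj X ◁ (bigTensor C).map f) ≫
      (bigTensorμIso _ _).hom)
  whiskerRight f Y := Strictification.homMk
    ((bigTensorμIso _ _).inv ≫ ((bigTensor C).map f ▷ (bigTensor C).obj Y) ≫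
      (bigTensorμIso _ _).hom)
  tensorHom f g := Strictification.homMk
    ((bigTensorμIso _ _).inv ≫ ((bigTensor C).map f ⊗ₘ (bigTensor C).map g) ≫
      (bigTensorμIso _ _).hom)
  associator X Y Z := eqToIso (Word.append_assoc X.word Y.word Z.word)
  leftUnitor X := eqToIso (Word.nil_append X.word)
  rightUnitor _ := Iso.refl _

theorem Word.snocIso_eqToHom {w w' : Word C} (h : w = w') (c : C) :
    (Word.snocIso w c).hom ≫ eqToHom (by rw [h]) =
      eqToHom (by rw [h]) ≫ (Word.snocIso w' c).hom := by
  subst h; simp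

theorem Word.eqToHom_whiskerRight {w w' : Word C} (h : w = w') (c : C) :
    eqToHom (congrArg Word.tensor h) ▷ c =
      eqToHom (congrArg (fun z => Word.tensor z ⊗ c) h) := by
  subst h; simp

theorem Word.appendIso_assoc (w₁ w₂ : Word C) : ∀ w₃ : Word C,
    ((Word.appendIso w₁ w₂).hom ▷ w₃.tensor) ≫ (Word.appendIso (w₁.append w₂) w₃).hom ≫
        eqToHom (congrArg Word.tensor (Word.append_assoc w₁ w₂ w₃)) =
      (α_ _ _ _).hom ≫ (w₁.tensor ◁ (Word.appendIso w₂ w₃).hom) ≫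
        (Word.appendIso w₁ (w₂.append w₃)).hom
  | .nil => by
      simp [Word.appendIso, Word.append, Word.tensor]
  | .snoc w₃ c => by
      have ih := Word.appendIso_assoc w₁ w₂ w₃
      have key := Word.snocIso_eqToHom (Word.append_assoc w₁ w₂ w₃) c
      have e := Word.eqToHom_whiskerRight (Word.append_assoc w₁ w₂ w₃) c
      have ih' := congrArg (fun f => f ▷ c) ih
      simp only [comp_whiskerRight, e] at ih'
      simp only [Word.appendIso, Word.append, Iso.trans_hom, whiskerLeftIso_hom, Iso.symm_hom,
        whiskerRightIso_hom, Category.assoc] at key ⊢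
      erw [key]
      rw [← cancel_epi ((w₁.tensor ⊗ w₂.tensor) ◁ (Word.snocIso w₃ c).hom),
        ← cancel_epi (α_ (w₁.tensor ⊗ w₂.tensor) w₃.tensor c).hom]
      simp only [← whisker_exchange_assoc, whiskerLeft_hom_inv_assoc]
      simp only [associator_inv_naturality_left_assoc, Iso.hom_inv_id_assoc]
      erw [reassoc_of% ih']
      simp only [whiskerLeft_comp, Category.assoc]
      simp

theorem Word.nil_appendIso : ∀ w : Word C,
    (Word.appendIso .nil w).hom ≫ eqToHom (congrArg Word.tensor (Word.nil_append w)) =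
      (λ_ w.tensor).hom
  | .nil => by
      simp [Word.appendIso, Word.append, Word.tensor, unitors_equal]
  | .snoc w c => by
      have ih := Word.nil_appendIso w
      have key := Word.snocIso_eqToHom (Word.nil_append w) c
      have e := Word.eqToHom_whiskerRight (Word.nil_append w) c
      have ih' := congrArg (fun f => f ▷ c) ih
      simp only [comp_whiskerRight, e] at ih'
      simp only [Word.appendIso, Word.append, Iso.trans_hom, whiskerLeftIso_hom, Iso.symm_hom,
        whiskerRightIso_hom, Category.assoc] at key ⊢
      erw [key]
      erw [reassoc_of% ih']
      simp [Word.tensor]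

/-- The comparison data between the monoidal structures of the strictification and of `C`. -/
def bigTensorData : Monoidal.InducingFunctorData (bigTensor C) where
  μIso := bigTensorμIso
  εIso := Iso.refl (𝟙_ C)
  whiskerLeft_eq _ _ _ _ := rfl
  whiskerRight_eq _ _ := rfl
  tensorHom_eq _ _ := rfl
  associator_eq X Y Z := by
    have h := Word.appendIso_assoc X.word Y.word Z.word
    have e : (bigTensor C).map (α_ X Y Z).hom =
        eqToHom (congrArg Word.tensor (Word.append_assoc X.word Y.word Z.word)) :=
      eqToHom_map (bigTensor C) (show (X ⊗ Y) ⊗ Z = X ⊗ (Y ⊗ Z) from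
        Word.append_assoc X.word Y.word Z.word)
    simp only [Iso.trans_hom, Iso.symm_hom, tensorIso_hom, Iso.refl_hom, tensorHom_id,
      id_tensorHom, Category.assoc]
    rw [Iso.eq_inv_comp]
    rw [← cancel_epi ((bigTensorμIso X Y).hom ▷ (bigTensor C).obj Z),
      hom_inv_whiskerRight_assoc]
    erw [e]
    exact h
  leftUnitor_eq X := by
    have h := Word.nil_appendIso X.word
    have e : (bigTensor C).map (λ_ X).hom =
        eqToHom (congrArg Word.tensor (Word.nil_append X.word)) :=
      eqToHom_map (bigTensor C) (show 𝟙_ (Strictification C) ⊗ X = X from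
        Word.nil_append X.word)
    simp only [Iso.trans_hom, Iso.symm_hom, tensorIso_hom, Iso.refl_hom, Category.assoc]
    rw [Iso.eq_inv_comp]
    erw [e]
    refine h.trans ?_
    erw [id_tensorHom_id, Category.id_comp]
    rfl
  rightUnitor_eq X := by
    simp only [Iso.trans_hom, Iso.symm_hom, tensorIso_hom, Iso.refl_hom, Category.assoc]
    rw [Iso.eq_inv_comp]
    erw [id_tensorHom_id, Category.id_comp, (bigTensor C).map_id, Category.comp_id]
    rfl

instance : MonoidalCategory (Strictification C) := Monoidal.induced (bigTensor C) bigTensorData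

instance : IsStrictMonoidal (Strictification C) where
  tensor_assoc X Y Z := Word.append_assoc X.word Y.word Z.word
  unit_tensor X := Word.nil_append X.word
  tensor_unit _ := rfl
  associator_eq _ _ _ := rfl
  leftUnitor_eq _ := rfl
  rightUnitor_eq _ := rfl

/-- `⨂` is strong monoidal, with the canonical isomorphisms as strongators. -/
instance : (bigTensor C).Monoidal := Monoidal.fromInducedMonoidal (bigTensor C) bigTensorData

end Strictification

section SymmetricStrictification

variable {C : Type u₁} [Category.{v₁} C] [MonoidalCategory C] [SymmetricCategory C]

/-- The braiding of the strictification is the one of `C`, carried along `⨂ X ⊗ ⨂ Y ≅ ⨂ (X · Y)`. -/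
def Strictification.braidingIso (X Y : Strictification C) : X ⊗ Y ≅ Y ⊗ X :=
  InducedCategory.isoMk ((bigTensorμIso X Y).symm ≪≫
    β_ ((bigTensor C).obj X) ((bigTensor C).obj Y) ≪≫ bigTensorμIso Y X)

theorem Strictification.braidingIso_spec (X Y : Strictification C) :
    Functor.LaxMonoidal.μ (bigTensor C) X Y ≫
        (bigTensor C).map (Strictification.braidingIso X Y).hom =
      (β_ ((bigTensor C).obj X) ((bigTensor C).obj Y)).hom ≫
        Functor.LaxMonoidal.μ (bigTensor C) Y X :=
  Iso.hom_inv_id_assoc (bigTensorμIso X Y) _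

instance : BraidedCategory (Strictification C) :=
  BraidedCategory.ofFaithful (bigTensor C) Strictification.braidingIso
    Strictification.braidingIso_spec

/-- `⨂` is a strong symmetric monoidal functor. -/
instance : (bigTensor C).Braided where
  braided := Strictification.braidingIso_spec

instance : SymmetricCategory (Strictification C) := SymmetricCategory.ofFaithful (bigTensor C)

end SymmetricStrictification

/-! ### The induced supply -/

section Induced

variable {C : Type u₁} [Category.{v₁} C] [MonoidalCategory C]

/-- The one-entry list `[c]` as an object of the strictification. -/
def Strictification.single (c : C) : Strictification C := Strictification.of (Word.single c)

/-- In the strictification, `[c]^{⊗n} = [c, …, c]`. -/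
theorem Strictification.tpow_single (c : C) :
    ∀ n : ℕ, tpow (Strictification.single c) n = Strictification.of (Word.replicate c n)
  | 0 => rfl
  | 1 => rfl
  | n + 2 => congrArg (fun X => X ⊗ Strictification.single c) (tpow_single c (n + 1))

/-- In the strictification, `[c₁] ⊗ ⋯ ⊗ [cₖ] = [c₁, …, cₖ]`. -/
theorem Strictification.tensor_single :
    ∀ w : Word C, (w.map Strictification.single).tensor = Strictification.of w
  | .nil => rfl
  | .snoc .nil _ => rfl
  | .snoc (.snoc w d) c =>
      congrArg (fun X => X ⊗ Strictification.single c) (tensor_single (.snoc w d))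

variable [SymmetricCategory C]
variable {P : Type u} [Category.{v} P] [MonoidalCategory P] [SymmetricCategory P] [PROP P]

/-- The morphism `s_{[c]}(μ) : [c]^{⊗m} ⟶ [c]^{⊗n}` of the strictification, which is the morphism
`s_c(μ) : c^{⊗m} ⟶ c^{⊗n}` of `C` read as a morphism `[c, …, c] ⟶ [c, …, c]`. -/
def Supply.strictSingle (s : Supply P C) (c : C) {p q : P} (μ : p ⟶ q) :
    tpow (Strictification.single c) (PROP.size p) ⟶
      tpow (Strictification.single c) (PROP.size q) :=
  eqToHom (Strictification.tpow_single c (PROP.size p)) ≫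
    (Strictification.homMk (s.map c μ) :
      Strictification.of (Word.replicate c (PROP.size p)) ⟶
        Strictification.of (Word.replicate c (PROP.size q))) ≫
    eqToHom (Strictification.tpow_single c (PROP.size q)).symm

/-- For `L = [c₁, …, cₖ]`, the morphism `L^{⊗m} ⟶ L^{⊗n}` of the strictification obtained from
`s_{[c₁]}(μ) ⊗ ⋯ ⊗ s_{[cₖ]}(μ)` by conjugating with the symmetry isomorphisms
`σ : [c₁]^{⊗m} ⊗ ⋯ ⊗ [cₖ]^{⊗m} ≅ L^{⊗m}`. -/
def Supply.strictMap (s : Supply P C) (L : Strictification C) {p q : P} (μ : p ⟶ q) :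
    tpow L (PROP.size p) ⟶ tpow L (PROP.size q) :=
  eqToHom (congrArg (fun X => tpow X (PROP.size p))
      (Strictification.tensor_single L.word).symm) ≫
    (sigmaWord Strictification.single (PROP.size p) L.word).inv ≫
    Word.tensorMap (fun c => s.strictSingle c μ) L.word ≫
    (sigmaWord Strictification.single (PROP.size q) L.word).hom ≫
    eqToHom (congrArg (fun X => tpow X (PROP.size q)) (Strictification.tensor_single L.word))

/-- `t` is the supply in the strictification induced by the supply `s` in `C`: for every object
`L` and every `μ : m ⟶ n` in `P`, the morphism `t_L(μ)` is `s.strictMap L μ`. (The functors `t_L`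
and their strongators are then determined, as `t` is a supply.) -/
def IsInducedSupply (s : Supply P C) (t : Supply P (Strictification C)) : Prop :=
  ∀ (L : Strictification C) {p q : P} (μ : p ⟶ q), t.map L μ = s.strictMap L μ

end Induced

/-! A supply is not natural in `c`, but its two conditions on `σ` force naturality for coherence
isomorphisms. The reason is that, for fixed `n`, the assignment `c ↦ c^{⊗n}` on objects and
isomorphisms satisfies the strong monoidal axioms with `σ` as strongator (`sigmaPair_associativity`,
`sigmaUnit_left_unitality`, `sigmaUnit_right_unitality`). Hence the isomorphisms whose tensor powers
commute with all supplied maps include associators and unitors, and are closed under composition,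
inverses and products (`Supply.IsNatural`).

A supply `s` in `C` then pulls back along any fully faithful symmetric strong monoidal `F : D ⥤ C`
whose strongators are natural in this sense: `s_{F(d)}(μ)`, conjugated by `F(d)^{⊗n} ≅ F(d^{⊗n})`,
has a unique preimage under `F`. Each supply axiom in `D` follows from the one in `C`, because these
strongators carry the coherence maps and `σ` of `C` to those of `D` (`tpowStrongator_tpowAdd`,
`tpowStrongator_sigmaUnit`, `tpowStrongator_sigmaPair`). The functor `⨂` qualifies, its strongators
being coherence isomorphisms.

It remains to recognise the pulled-back maps. In any supply the map of an iterated product is the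
`σ`-conjugate of the product of the maps of its factors (`Supply.tensorMap_sigmaWord`). In the
strictification `L` is the product of its one-entry lists, on which the strongators of `⨂` are
identities. So the pulled-back map at `L` is the prescribed one
(`Strictification.strictMap_eq_pullbackMap`), and preservation is its defining property. -/

/-! ### Tensor powers and the coherence of `σ` -/

section TensorPowers

variable {C : Type u₁} [Category.{v₁} C] [MonoidalCategory C]

theorem tpowMapIso_succ_hom {c d : C} (f : c ≅ d) (n : ℕ) :
    (tpowMapIso f (n + 1)).hom =
      (tpowSucc c n).inv ≫ ((tpowMapIso f n).hom ⊗ₘ f.hom) ≫ (tpowSucc d n).hom := rfl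

theorem tpowMapIso_refl_hom (c : C) : ∀ n : ℕ, (tpowMapIso (Iso.refl c) n).hom = 𝟙 _
  | 0 => rfl
  | n + 1 => by
      rw [tpowMapIso_succ_hom, tpowMapIso_refl_hom c n]
      simp

theorem tpowMapIso_trans_hom {c d e : C} (f : c ≅ d) (g : d ≅ e) : ∀ n : ℕ,
    (tpowMapIso (f ≪≫ g) n).hom = (tpowMapIso f n).hom ≫ (tpowMapIso g n).hom
  | 0 => (Category.id_comp (𝟙 (𝟙_ C))).symm
  | n + 1 => by
      simp only [tpowMapIso_succ_hom, tpowMapIso_trans_hom f g n, Iso.trans_hom, Category.assoc,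
        Iso.hom_inv_id_assoc, tensorHom_comp_tensorHom_assoc]

theorem sigmaUnit_succ_hom (n : ℕ) :
    (sigmaUnit (C := C) (n + 1)).hom =
      (λ_ (𝟙_ C)).inv ≫ ((sigmaUnit n).hom ▷ 𝟙_ C) ≫ (tpowSucc (𝟙_ C) n).hom := rfl

theorem tpowAdd_succ_hom (c : C) (m n : ℕ) :
    (tpowAdd c m (n + 1)).hom =
      (tpow c m ◁ (tpowSucc c n).inv) ≫ (α_ (tpow c m) (tpow c n) c).inv ≫
        ((tpowAdd c m n).hom ▷ c) ≫ (tpowSucc c (m + n)).hom := rfl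

end TensorPowers

section SymmetricTensorPowers

variable {C : Type u₁} [Category.{v₁} C] [MonoidalCategory C] [SymmetricCategory C]

theorem sigmaPair_succ_hom (c d : C) (n : ℕ) :
    (sigmaPair c d (n + 1)).hom =
      ((tpowSucc c n).inv ⊗ₘ (tpowSucc d n).inv) ≫ tensorμ (tpow c n) c (tpow d n) d ≫
        ((sigmaPair c d n).hom ▷ (c ⊗ d)) ≫ (tpowSucc (c ⊗ d) n).hom := rfl

theorem sigmaPair_natural {c c' d d' : C} (f : c ≅ c') (g : d ≅ d') : ∀ n : ℕ,
    ((tpowMapIso f n).hom ⊗ₘ (tpowMapIso g n).hom) ≫ (sigmaPair c' d' n).hom =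
      (sigmaPair c d n).hom ≫ (tpowMapIso (f ⊗ᵢ g) n).hom
  | 0 => by
      change (𝟙 (𝟙_ C) ⊗ₘ 𝟙 (𝟙_ C)) ≫ (λ_ (𝟙_ C)).hom = (λ_ (𝟙_ C)).hom ≫ 𝟙 (𝟙_ C)
      simp
  | n + 1 => by
      have ih := sigmaPair_natural f g n
      simp only [tpowMapIso_succ_hom, sigmaPair_succ_hom, tensorIso_hom, Category.assoc,
        Iso.hom_inv_id_assoc]
      simp only [tensorHom_comp_tensorHom_assoc, Category.assoc, Iso.hom_inv_id, Category.comp_id]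
      simp only [← tensorHom_comp_tensorHom, Category.assoc, tensorμ_natural_assoc]
      simp only [← tensorHom_id, tensorHom_comp_tensorHom_assoc, ih, Category.comp_id,
        Category.id_comp]

/-- The recursion for `σ` with the isomorphisms `tpowSucc` moved to the other side, so that the
inductions below can precompose with them and cancel. -/
theorem tpowSucc_sigmaPair (c d : C) (n : ℕ) :
    ((tpowSucc c n).hom ⊗ₘ (tpowSucc d n).hom) ≫ (sigmaPair c d (n + 1)).hom =
      tensorμ (tpow c n) c (tpow d n) d ≫
        ((sigmaPair c d n).hom ⊗ₘ 𝟙 (c ⊗ d)) ≫ (tpowSucc (c ⊗ d) n).hom := by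
  rw [sigmaPair_succ_hom, tensorHom_comp_tensorHom_assoc]
  simp

/-- The associativity axiom of a monoidal functor, for `c ↦ c^{⊗n}` with strongator `σ`. The
inductive step splits into the hypothesis on the first `n` factors and the coherence of the
interchange `tensorμ`. -/
theorem sigmaPair_associativity (a b c : C) : ∀ n : ℕ,
    ((sigmaPair a b n).hom ⊗ₘ 𝟙 (tpow c n)) ≫ (sigmaPair (a ⊗ b) c n).hom ≫
        (tpowMapIso (α_ a b c) n).hom =
      (α_ (tpow a n) (tpow b n) (tpow c n)).hom ≫ (𝟙 (tpow a n) ⊗ₘ (sigmaPair b c n).hom) ≫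
        (sigmaPair a (b ⊗ c) n).hom
  | 0 => by
      change ((λ_ (𝟙_ C)).hom ⊗ₘ 𝟙 (𝟙_ C)) ≫ (λ_ (𝟙_ C)).hom ≫ 𝟙 (𝟙_ C) =
        (α_ (𝟙_ C) (𝟙_ C) (𝟙_ C)).hom ≫ (𝟙 (𝟙_ C) ⊗ₘ (λ_ (𝟙_ C)).hom) ≫ (λ_ (𝟙_ C)).hom
      monoidal
  | n + 1 => by
      have ih := sigmaPair_associativity a b c n
      have hl : (((tpowSucc a n).hom ⊗ₘ (tpowSucc b n).hom) ⊗ₘ (tpowSucc c n).hom) ≫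
          ((sigmaPair a b (n + 1)).hom ⊗ₘ 𝟙 (tpow c (n + 1))) =
          (tensorμ (tpow a n) a (tpow b n) b ⊗ₘ 𝟙 (tpow c n ⊗ c)) ≫
            (((sigmaPair a b n).hom ⊗ₘ 𝟙 (a ⊗ b)) ⊗ₘ (𝟙 (tpow c n) ⊗ₘ 𝟙 c)) ≫
            ((tpowSucc (a ⊗ b) n).hom ⊗ₘ (tpowSucc c n).hom) := by
        simp only [tensorHom_comp_tensorHom, tpowSucc_sigmaPair, id_tensorHom_id,
          Category.id_comp, Category.comp_id]
      have hr : ((tpowSucc a n).hom ⊗ₘ (tpowSucc b n).hom ⊗ₘ (tpowSucc c n).hom) ≫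
          (𝟙 (tpow a (n + 1)) ⊗ₘ (sigmaPair b c (n + 1)).hom) =
          (𝟙 (tpow a n ⊗ a) ⊗ₘ tensorμ (tpow b n) b (tpow c n) c) ≫
            ((𝟙 (tpow a n) ⊗ₘ 𝟙 a) ⊗ₘ ((sigmaPair b c n).hom ⊗ₘ 𝟙 (b ⊗ c))) ≫
            ((tpowSucc a n).hom ⊗ₘ (tpowSucc (b ⊗ c) n).hom) := by
        simp only [tensorHom_comp_tensorHom, tpowSucc_sigmaPair, id_tensorHom_id,
          Category.id_comp, Category.comp_id]
      rw [← cancel_epi (((tpowSucc a n).hom ⊗ₘ (tpowSucc b n).hom) ⊗ₘ (tpowSucc c n).hom),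
        associator_naturality_assoc, reassoc_of% hl, reassoc_of% hr,
        reassoc_of% tpowSucc_sigmaPair (a ⊗ b) c n, tpowSucc_sigmaPair a (b ⊗ c) n,
        tpowMapIso_succ_hom, Iso.hom_inv_id_assoc, tensorμ_natural_assoc, tensorμ_natural_assoc]
      -- The interchange makes `⊗ : C × C ⥤ C` monoidal; this is its associativity axiom.
      have e := tensor_associativity (tpow a n) a (tpow b n) b (tpow c n) c
      rw [← tensorHom_id, ← id_tensorHom] at e
      rw [← reassoc_of% e]
      simp only [tensorHom_comp_tensorHom_assoc, ih, Category.id_comp, id_tensorHom_id,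
        Category.comp_id]

theorem sigmaUnit_left_unitality (c : C) : ∀ n : ℕ,
    ((sigmaUnit n).hom ⊗ₘ 𝟙 (tpow c n)) ≫ (sigmaPair (𝟙_ C) c n).hom ≫
        (tpowMapIso (λ_ c) n).hom = (λ_ (tpow c n)).hom
  | 0 => by
      change (𝟙 (𝟙_ C) ⊗ₘ 𝟙 (𝟙_ C)) ≫ (λ_ (𝟙_ C)).hom ≫ 𝟙 (𝟙_ C) = (λ_ (𝟙_ C)).hom
      simp
  | n + 1 => by
      have ih := sigmaUnit_left_unitality c n
      have hl : (𝟙_ C ◁ (tpowSucc c n).hom) ≫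
          ((sigmaUnit (n + 1)).hom ⊗ₘ 𝟙 (tpow c (n + 1))) =
          ((λ_ (𝟙_ C)).inv ▷ (tpow c n ⊗ c)) ≫
            (((sigmaUnit n).hom ⊗ₘ 𝟙 (𝟙_ C)) ⊗ₘ (𝟙 (tpow c n) ⊗ₘ 𝟙 c)) ≫
            ((tpowSucc (𝟙_ C) n).hom ⊗ₘ (tpowSucc c n).hom) := by
        simp only [sigmaUnit_succ_hom, ← tensorHom_id, ← id_tensorHom, tensorHom_comp_tensorHom,
          id_tensorHom_id, Category.id_comp, Category.comp_id]
      rw [← cancel_epi (𝟙_ C ◁ (tpowSucc c n).hom), leftUnitor_naturality, reassoc_of% hl,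
        reassoc_of% tpowSucc_sigmaPair, tpowMapIso_succ_hom, Iso.hom_inv_id_assoc,
        tensorμ_natural_assoc, tensor_left_unitality]
      simp only [tensorHom_comp_tensorHom_assoc, ih, Category.id_comp, id_tensorHom_id,
        Category.assoc]

theorem sigmaUnit_right_unitality (c : C) : ∀ n : ℕ,
    (𝟙 (tpow c n) ⊗ₘ (sigmaUnit n).hom) ≫ (sigmaPair c (𝟙_ C) n).hom ≫
        (tpowMapIso (ρ_ c) n).hom = (ρ_ (tpow c n)).hom
  | 0 => by
      change (𝟙 (𝟙_ C) ⊗ₘ 𝟙 (𝟙_ C)) ≫ (λ_ (𝟙_ C)).hom ≫ 𝟙 (𝟙_ C) = (ρ_ (𝟙_ C)).hom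
      simp [unitors_equal]
  | n + 1 => by
      have ih := sigmaUnit_right_unitality c n
      have hr : ((tpowSucc c n).hom ▷ 𝟙_ C) ≫
          (𝟙 (tpow c (n + 1)) ⊗ₘ (sigmaUnit (n + 1)).hom) =
          ((tpow c n ⊗ c) ◁ (λ_ (𝟙_ C)).inv) ≫
            ((𝟙 (tpow c n) ⊗ₘ 𝟙 c) ⊗ₘ ((sigmaUnit n).hom ⊗ₘ 𝟙 (𝟙_ C))) ≫
            ((tpowSucc c n).hom ⊗ₘ (tpowSucc (𝟙_ C) n).hom) := by
        simp only [sigmaUnit_succ_hom, ← tensorHom_id, ← id_tensorHom, tensorHom_comp_tensorHom,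
          id_tensorHom_id, Category.id_comp, Category.comp_id]
      rw [← cancel_epi ((tpowSucc c n).hom ▷ 𝟙_ C), rightUnitor_naturality, reassoc_of% hr,
        reassoc_of% tpowSucc_sigmaPair, tpowMapIso_succ_hom, Iso.hom_inv_id_assoc,
        tensorμ_natural_assoc, tensor_right_unitality]
      simp only [tensorHom_comp_tensorHom_assoc, ih, Category.id_comp, id_tensorHom_id,
        Category.assoc]

end SymmetricTensorPowers

/-! ### Strong monoidal functors and tensor powers -/

section Strongators

variable {C : Type u₁} [Category.{v₁} C] [MonoidalCategory C]
  {D : Type u₂} [Category.{v₂} D] [MonoidalCategory D] (F : C ⥤ D)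

open Functor.LaxMonoidal

theorem tpowSucc_tpowStrongator [F.Monoidal] (c : C) (n : ℕ) :
    (tpowSucc (F.obj c) n).hom ≫ (tpowStrongator F c (n + 1)).hom =
      ((tpowStrongator F c n).hom ▷ F.obj c) ≫ μ F (tpow c n) c ≫ F.map (tpowSucc c n).hom :=
  Iso.hom_inv_id_assoc (tpowSucc (F.obj c) n) _

theorem tpowStrongator_tpowAdd [F.Monoidal] (c : C) (m : ℕ) : ∀ n : ℕ,
    ((tpowStrongator F c m).hom ⊗ₘ (tpowStrongator F c n).hom) ≫ μ F (tpow c m) (tpow c n) ≫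
        F.map (tpowAdd c m n).hom =
      (tpowAdd (F.obj c) m n).hom ≫ (tpowStrongator F c (m + n)).hom
  | 0 => by
      change ((tpowStrongator F c m).hom ⊗ₘ ε F) ≫ μ F (tpow c m) (𝟙_ C) ≫
        F.map (ρ_ (tpow c m)).hom = (ρ_ (tpow (F.obj c) m)).hom ≫ (tpowStrongator F c m).hom
      rw [← rightUnitor_naturality, right_unitality, tensorHom_def_assoc]
  | n + 1 => by
      have ih := tpowStrongator_tpowAdd c m n
      have h₁ : (tpow (F.obj c) m ◁ (tpowSucc (F.obj c) n).hom) ≫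
          ((tpowStrongator F c m).hom ⊗ₘ (tpowStrongator F c (n + 1)).hom) =
          ((tpowStrongator F c m).hom ⊗ₘ (tpowStrongator F c n).hom ▷ F.obj c) ≫
            (F.obj (tpow c m) ◁ μ F (tpow c n) c) ≫
              (F.obj (tpow c m) ◁ F.map (tpowSucc c n).hom) := by
        simp only [← id_tensorHom, tensorHom_comp_tensorHom, tpowSucc_tpowStrongator,
          Category.id_comp, Category.comp_id]
      have h₂ := associator_inv_naturality (tpowStrongator F c m).hom (tpowStrongator F c n).hom
        (𝟙 (F.obj c))
      rw [tensorHom_id, tensorHom_id] at h₂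
      have ih' := congrArg (fun f => f ▷ F.obj c) ih
      simp only [comp_whiskerRight] at ih'
      rw [← cancel_epi (tpow (F.obj c) m ◁ (tpowSucc (F.obj c) n).hom), reassoc_of% h₁,
        μ_natural_right_assoc, tpowAdd_succ_hom, tpowAdd_succ_hom]
      simp only [F.map_comp, Category.assoc]
      -- The exponents `m + (n + 1)` and `(m + n) + 1` agree by definition; the ascription gives the
      -- form in which the goal displays them.
      have h₃ : (tpowSucc (F.obj c) (m + n)).hom ≫ (tpowStrongator F c (m + (n + 1))).hom = _ :=
        tpowSucc_tpowStrongator F c (m + n)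
      rw [h₃, ← reassoc_of% ih', whiskerLeft_hom_inv_assoc,
        ← Functor.map_comp_assoc, ← MonoidalCategory.whiskerLeft_comp, Iso.hom_inv_id,
        MonoidalCategory.whiskerLeft_id, F.map_id, Category.id_comp,
        associativity_inv_assoc, reassoc_of% h₂, μ_natural_left_assoc]

theorem tpowStrongator_sigmaUnit [F.Monoidal] : ∀ n : ℕ,
    ε F ≫ F.map (sigmaUnit n).hom =
      (sigmaUnit n).hom ≫ (tpowMapIso (Functor.Monoidal.εIso F) n).hom ≫
        (tpowStrongator F (𝟙_ C) n).hom
  | 0 => by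
      change ε F ≫ F.map (𝟙 (𝟙_ C)) = 𝟙 (𝟙_ D) ≫ 𝟙 (𝟙_ D) ≫ ε F
      simp
  | n + 1 => by
      have ih := tpowStrongator_sigmaUnit n
      have ih' := congrArg (fun f => f ▷ 𝟙_ D) ih
      simp only [comp_whiskerRight] at ih'
      simp only [tpowMapIso_succ_hom, sigmaUnit_succ_hom, Category.assoc, Iso.hom_inv_id_assoc,
        tpowSucc_tpowStrongator, F.map_comp]
      rw [MonoidalCategory.tensorHom_def, Category.assoc, whisker_exchange_assoc,
        ← reassoc_of% ih', Functor.Monoidal.εIso_hom, ← left_unitality_inv, Category.assoc,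
        leftUnitor_inv_naturality_assoc, Category.assoc, ← μ_natural_left_assoc,
        whisker_exchange_assoc, whisker_exchange_assoc]

end Strongators

/-- Since `σ` permutes factors, `F` has to be braided here: its strongators then carry the
interchange of `D` to that of `C`. -/
theorem tpowStrongator_sigmaPair {C : Type u₁} [Category.{v₁} C] [MonoidalCategory C]
    [SymmetricCategory C] {D : Type u₂} [Category.{v₂} D] [MonoidalCategory D]
    [SymmetricCategory D] (F : C ⥤ D) [F.Braided] (c d : C) : ∀ n : ℕ,
    ((tpowStrongator F c n).hom ⊗ₘ (tpowStrongator F d n).hom) ≫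
        Functor.LaxMonoidal.μ F (tpow c n) (tpow d n) ≫ F.map (sigmaPair c d n).hom =
      (sigmaPair (F.obj c) (F.obj d) n).hom ≫
        (tpowMapIso (Functor.Monoidal.μIso F c d) n).hom ≫ (tpowStrongator F (c ⊗ d) n).hom
  | 0 => by
      change (Functor.LaxMonoidal.ε F ⊗ₘ Functor.LaxMonoidal.ε F) ≫
        Functor.LaxMonoidal.μ F (𝟙_ C) (𝟙_ C) ≫ F.map (λ_ (𝟙_ C)).hom =
          (λ_ (𝟙_ D)).hom ≫ 𝟙 (𝟙_ D) ≫ Functor.LaxMonoidal.ε F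
      rw [Category.id_comp, ← leftUnitor_naturality, Functor.LaxMonoidal.left_unitality,
        tensorHom_def'_assoc]
  | n + 1 => by
      have ih := tpowStrongator_sigmaPair F c d n
      have h₁ : ((tpowSucc (F.obj c) n).hom ⊗ₘ (tpowSucc (F.obj d) n).hom) ≫
          ((tpowStrongator F c (n + 1)).hom ⊗ₘ (tpowStrongator F d (n + 1)).hom) =
          (((tpowStrongator F c n).hom ⊗ₘ 𝟙 _) ⊗ₘ ((tpowStrongator F d n).hom ⊗ₘ 𝟙 _)) ≫
            (Functor.LaxMonoidal.μ F (tpow c n) c ⊗ₘ Functor.LaxMonoidal.μ F (tpow d n) d) ≫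
              (F.map (tpowSucc c n).hom ⊗ₘ F.map (tpowSucc d n).hom) := by
        simp only [tensorHom_comp_tensorHom, tpowSucc_tpowStrongator, tensorHom_id]
      rw [← cancel_epi ((tpowSucc (F.obj c) n).hom ⊗ₘ (tpowSucc (F.obj d) n).hom),
        reassoc_of% h₁, Functor.LaxMonoidal.μ_natural_assoc, ← F.map_comp, tpowSucc_sigmaPair,
        reassoc_of% tpowSucc_sigmaPair, tpowMapIso_succ_hom, F.map_comp, F.map_comp,
        ← tensorμ_comp_μ_tensorHom_μ_comp_μ_assoc, tensorμ_natural_assoc,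
        Category.assoc, Category.assoc, tpowSucc_tpowStrongator, Iso.hom_inv_id_assoc,
        ← Functor.LaxMonoidal.μ_natural_assoc, ← tensorHom_id]
      simp only [tensorHom_comp_tensorHom_assoc, ih, Category.id_comp,
        Category.comp_id, F.map_id, id_tensorHom_id, Functor.Monoidal.μIso_hom]

/-! ### Naturality of a supply in coherence isomorphisms -/

namespace Supply

variable {P : Type u} [Category.{v} P] [MonoidalCategory P] [SymmetricCategory P] [PROP P]
  {C : Type u₁} [Category.{v₁} C] [MonoidalCategory C] [SymmetricCategory C] (s : Supply P C)

theorem map_sigmaPair (c d : C) {p q : P} (μ : p ⟶ q) :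
    (s.map c μ ⊗ₘ s.map d μ) ≫ (sigmaPair c d (PROP.size q)).hom =
      (sigmaPair c d (PROP.size p)).hom ≫ s.map (c ⊗ d) μ :=
  s.map_tensor c d μ

theorem sigmaUnit_map {p q : P} (μ : p ⟶ q) :
    (sigmaUnit (PROP.size p)).hom ≫ s.map (𝟙_ C) μ = (sigmaUnit (PROP.size q)).hom :=
  (s.map_unit μ).symm

/-- The supplied morphisms commute with the tensor powers of the isomorphism `f`. Supplies are not
required to be natural in `C`, but they are natural with respect to coherence isomorphisms. -/
def IsNatural {c d : C} (f : c ≅ d) : Prop :=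
  ∀ ⦃p q : P⦄ (μ : p ⟶ q), (tpowMapIso f (PROP.size p)).hom ≫ s.map d μ =
    s.map c μ ≫ (tpowMapIso f (PROP.size q)).hom

variable {s}

theorem isNatural_eqToIso {c d : C} (h : c = d) : s.IsNatural (eqToIso h) := by
  subst h
  intro p q μ
  simp only [eqToIso_refl, tpowMapIso_refl_hom, Category.id_comp, Category.comp_id]

theorem isNatural_refl (c : C) : s.IsNatural (Iso.refl c) := isNatural_eqToIso rfl

theorem IsNatural.trans {c d e : C} {f : c ≅ d} {g : d ≅ e} (hf : s.IsNatural f)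
    (hg : s.IsNatural g) : s.IsNatural (f ≪≫ g) := by
  intro p q μ
  rw [tpowMapIso_trans_hom, tpowMapIso_trans_hom, Category.assoc, hg μ, reassoc_of% hf μ]

theorem IsNatural.symm {c d : C} {f : c ≅ d} (hf : s.IsNatural f) : s.IsNatural f.symm := by
  have h (n : ℕ) : (tpowMapIso f n).hom ≫ (tpowMapIso f.symm n).hom = 𝟙 _ := by
    rw [← tpowMapIso_trans_hom, Iso.self_symm_id, tpowMapIso_refl_hom]
  intro p q μ
  rw [← cancel_epi (tpowMapIso f (PROP.size p)).hom, reassoc_of% h, reassoc_of% hf μ, h,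
    Category.comp_id]

/-- After precomposition with the isomorphism `σ`, the supplied map of a product becomes the product
of the supplied maps, where `hf` and `hg` apply factorwise. -/
theorem IsNatural.tensor {c c' d d' : C} {f : c ≅ c'} {g : d ≅ d'} (hf : s.IsNatural f)
    (hg : s.IsNatural g) : s.IsNatural (f ⊗ᵢ g) := by
  intro p q μ
  rw [← cancel_epi (sigmaPair c d (PROP.size p)).hom, ← reassoc_of% sigmaPair_natural,
    ← map_sigmaPair, ← reassoc_of% map_sigmaPair, ← sigmaPair_natural,
    tensorHom_comp_tensorHom_assoc, tensorHom_comp_tensorHom_assoc, hf μ, hg μ]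

theorem IsNatural.whiskerLeft (c : C) {d d' : C} {g : d ≅ d'} (hg : s.IsNatural g) :
    s.IsNatural (whiskerLeftIso c g) := by
  rw [show whiskerLeftIso c g = Iso.refl c ⊗ᵢ g by ext; simp]
  exact (isNatural_refl c).tensor hg

theorem IsNatural.whiskerRight {c c' : C} {f : c ≅ c'} (hf : s.IsNatural f) (d : C) :
    s.IsNatural (whiskerRightIso f d) := by
  rw [show whiskerRightIso f d = f ⊗ᵢ Iso.refl d by ext; simp]
  exact hf.tensor (isNatural_refl d)

/-- Up to `σ`, the maps of `(a ⊗ b) ⊗ c` and `a ⊗ (b ⊗ c)` are the two bracketings of one triple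
product, and `σ` turns the tensor power of the associator into the associator of tensor powers,
which is natural. -/
theorem isNatural_associator (a b c : C) : s.IsNatural (α_ a b c) := by
  intro p q μ
  have h₁ : ((sigmaPair a b (PROP.size p)).hom ⊗ₘ 𝟙 (tpow c (PROP.size p))) ≫
      (s.map (a ⊗ b) μ ⊗ₘ s.map c μ) = ((s.map a μ ⊗ₘ s.map b μ) ⊗ₘ s.map c μ) ≫
        ((sigmaPair a b (PROP.size q)).hom ⊗ₘ 𝟙 (tpow c (PROP.size q))) := by
    simp only [tensorHom_comp_tensorHom, map_sigmaPair, Category.id_comp, Category.comp_id]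
  have h₂ : (𝟙 (tpow a (PROP.size p)) ⊗ₘ (sigmaPair b c (PROP.size p)).hom) ≫
      (s.map a μ ⊗ₘ s.map (b ⊗ c) μ) = (s.map a μ ⊗ₘ (s.map b μ ⊗ₘ s.map c μ)) ≫
        (𝟙 (tpow a (PROP.size q)) ⊗ₘ (sigmaPair b c (PROP.size q)).hom) := by
    simp only [tensorHom_comp_tensorHom, map_sigmaPair, Category.id_comp, Category.comp_id]
  rw [← cancel_epi (sigmaPair (a ⊗ b) c (PROP.size p)).hom,
    ← cancel_epi ((sigmaPair a b (PROP.size p)).hom ⊗ₘ 𝟙 (tpow c (PROP.size p))),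
    reassoc_of% sigmaPair_associativity, ← map_sigmaPair, ← reassoc_of% map_sigmaPair,
    reassoc_of% h₁, reassoc_of% h₂, sigmaPair_associativity, associator_naturality_assoc]

theorem isNatural_leftUnitor (c : C) : s.IsNatural (λ_ c) := by
  intro p q μ
  have h : ((sigmaUnit (PROP.size p)).hom ⊗ₘ 𝟙 (tpow c (PROP.size p))) ≫
      (s.map (𝟙_ C) μ ⊗ₘ s.map c μ) =
        (𝟙_ C ◁ s.map c μ) ≫ ((sigmaUnit (PROP.size q)).hom ⊗ₘ 𝟙 (tpow c (PROP.size q))) := by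
    simp only [← id_tensorHom, tensorHom_comp_tensorHom, sigmaUnit_map, Category.id_comp,
      Category.comp_id]
  rw [← cancel_epi (sigmaPair (𝟙_ C) c (PROP.size p)).hom,
    ← cancel_epi ((sigmaUnit (PROP.size p)).hom ⊗ₘ 𝟙 (tpow c (PROP.size p))),
    reassoc_of% sigmaUnit_left_unitality, ← reassoc_of% map_sigmaPair, reassoc_of% h,
    sigmaUnit_left_unitality, leftUnitor_naturality]

theorem isNatural_rightUnitor (c : C) : s.IsNatural (ρ_ c) := by
  intro p q μ
  have h : (𝟙 (tpow c (PROP.size p)) ⊗ₘ (sigmaUnit (PROP.size p)).hom) ≫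
      (s.map c μ ⊗ₘ s.map (𝟙_ C) μ) =
        (s.map c μ ▷ 𝟙_ C) ≫ (𝟙 (tpow c (PROP.size q)) ⊗ₘ (sigmaUnit (PROP.size q)).hom) := by
    simp only [← tensorHom_id, tensorHom_comp_tensorHom, sigmaUnit_map, Category.id_comp,
      Category.comp_id]
  rw [← cancel_epi (sigmaPair c (𝟙_ C) (PROP.size p)).hom,
    ← cancel_epi (𝟙 (tpow c (PROP.size p)) ⊗ₘ (sigmaUnit (PROP.size p)).hom),
    reassoc_of% sigmaUnit_right_unitality, ← reassoc_of% map_sigmaPair, reassoc_of% h,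
    sigmaUnit_right_unitality, rightUnitor_naturality]

theorem isNatural_snocIso : ∀ (w : Word C) (c : C), s.IsNatural (Word.snocIso w c)
  | .nil, c => isNatural_leftUnitor c
  | .snoc _ _, _ => isNatural_refl _

/-- These isomorphisms are the strongators of `⨂`. -/
theorem isNatural_appendIso (w : Word C) : ∀ w' : Word C, s.IsNatural (Word.appendIso w w')
  | .nil => isNatural_rightUnitor _
  | .snoc w' c =>
      (IsNatural.whiskerLeft _ (isNatural_snocIso w' c).symm).trans <|
        (isNatural_associator _ _ _).symm.trans <|
          ((isNatural_appendIso w w').whiskerRight c).trans (isNatural_snocIso _ c)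

variable (s)

/-- Iterates the binary condition on `σ`. The isomorphism `Word.snocIso`, a unitor when the list
before it is empty, passes through by naturality. -/
theorem tensorMap_sigmaWord {ι : Type u₂} (X : ι → C) {p q : P} (μ : p ⟶ q) : ∀ w : Word ι,
    Word.tensorMap (fun i => s.map (X i) μ) w ≫ (sigmaWord X (PROP.size q) w).hom =
      (sigmaWord X (PROP.size p) w).hom ≫ s.map (w.map X).tensor μ
  | .nil => (Category.id_comp _).trans (s.sigmaUnit_map μ).symm
  | .snoc w i => by
      have ih := tensorMap_sigmaWord X μ w
      have h := isNatural_snocIso (s := s) (w.map X) (X i) μ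
      change ((Word.snocIso _ _).inv ≫ (Word.tensorMap (fun i => s.map (X i) μ) w ⊗ₘ s.map (X i) μ) ≫
          (Word.snocIso _ _).hom) ≫ (Word.snocIso _ _).inv ≫ ((sigmaWord X (PROP.size q) w).hom ▷ _) ≫
            (sigmaPair _ _ (PROP.size q)).hom ≫ (tpowMapIso _ (PROP.size q)).hom =
        ((Word.snocIso _ _).inv ≫ ((sigmaWord X (PROP.size p) w).hom ▷ _) ≫
          (sigmaPair _ _ (PROP.size p)).hom ≫ (tpowMapIso _ (PROP.size p)).hom) ≫
            s.map (Word.snoc (w.map X) (X i)).tensor μ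
      simp only [Category.assoc, Iso.hom_inv_id_assoc, h]
      rw [← tensorHom_id, ← tensorHom_id, tensorHom_comp_tensorHom_assoc, ih,
        ← reassoc_of% map_sigmaPair, tensorHom_comp_tensorHom_assoc, Category.id_comp,
        Category.comp_id]

theorem map_eqToHom {c d : C} (h : c = d) {p q : P} (μ : p ⟶ q) :
    s.map d μ = eqToHom (congrArg (fun X => tpow X (PROP.size p)) h.symm) ≫ s.map c μ ≫
      eqToHom (congrArg (fun X => tpow X (PROP.size q)) h) := by
  subst h
  simp

end Supply

/-! ### Lifting a monoidal structure through a fully faithful functor -/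

namespace CategoryTheory.Functor

open Functor.LaxMonoidal Functor.Monoidal

variable {P : Type u} [Category.{v} P] [MonoidalCategory P]
  {C : Type u₁} [Category.{v₁} C] [MonoidalCategory C]
  {D : Type u₂} [Category.{v₂} D] [MonoidalCategory D]

/-- If `F` is fully faithful and monoidal and `T ⋙ F` is monoidal, then so is `T`. -/
noncomputable def coreMonoidalOfComp (T : P ⥤ D) (F : D ⥤ C) [F.Monoidal] [F.Full] [F.Faithful]
    [(T ⋙ F).Monoidal] : T.CoreMonoidal where
  εIso := F.preimageIso ((εIso F).symm ≪≫ εIso (T ⋙ F))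
  μIso p q := F.preimageIso ((μIso F _ _).symm ≪≫ μIso (T ⋙ F) p q)
  μIso_hom_natural_left f r := by
    apply F.map_injective
    simp only [preimageIso_hom, F.map_comp, map_preimage, Iso.trans_hom, Iso.symm_hom, μIso_inv,
      μIso_hom, ← OplaxMonoidal.δ_natural_left_assoc, Category.assoc]
    exact congrArg _ (μ_natural_left (T ⋙ F) f r)
  μIso_hom_natural_right r f := by
    apply F.map_injective
    simp only [preimageIso_hom, F.map_comp, map_preimage, Iso.trans_hom, Iso.symm_hom, μIso_inv,
      μIso_hom, ← OplaxMonoidal.δ_natural_right_assoc, Category.assoc]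
    exact congrArg _ (μ_natural_right (T ⋙ F) r f)
  associativity p q r := by
    -- Under `F` the preimages unfold and each `μ` of `F` cancels against a `δ`; what is left is the
    -- same axiom for `T ⋙ F`.
    apply F.map_injective
    have h := associativity (T ⋙ F) p q r
    simp only [comp_map, comp_obj] at h
    simp only [preimageIso_hom, F.map_comp, map_preimage, Iso.trans_hom, Iso.symm_hom, μIso_inv,
      μIso_hom, map_whiskerLeft, map_whiskerRight, comp_whiskerRight, Category.assoc,
      MonoidalCategory.whiskerLeft_comp, μ_δ_assoc]
    rw [map_associator_assoc, μ_δ_assoc, whiskerLeft_μ_δ_assoc]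
    exact congrArg _ (congrArg _ h)
  left_unitality p := by
    apply F.map_injective
    have h := left_unitality (T ⋙ F) p
    simp only [preimageIso_hom, F.map_comp, map_preimage, Iso.trans_hom, Iso.symm_hom, μIso_inv,
      μIso_hom, εIso_inv, εIso_hom, map_whiskerRight, comp_whiskerRight, Category.assoc, μ_δ_assoc]
    rw [map_leftUnitor]
    exact congrArg _ (congrArg _ h)
  right_unitality p := by
    apply F.map_injective
    have h := right_unitality (T ⋙ F) p
    simp only [preimageIso_hom, F.map_comp, map_preimage, Iso.trans_hom, Iso.symm_hom, μIso_inv,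
      μIso_hom, εIso_inv, εIso_hom, map_whiskerLeft, MonoidalCategory.whiskerLeft_comp, Category.assoc,
      μ_δ_assoc]
    rw [map_rightUnitor]
    exact congrArg _ (congrArg _ h)

end CategoryTheory.Functor

theorem tpowStrongator_eqToHom {C : Type u₁} [Category.{v₁} C] [MonoidalCategory C]
    {D : Type u₂} [Category.{v₂} D] [MonoidalCategory D] (F : D ⥤ C) [F.Monoidal] (d : D)
    {m n : ℕ} (h : m = n) :
    (tpowStrongator F d m).hom ≫ F.map (eqToHom (congrArg (tpow d) h)) =
      eqToHom (congrArg (tpow (F.obj d)) h) ≫ (tpowStrongator F d n).hom := by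
  subst h
  simp

/-! ### Pulling a supply back along a fully faithful symmetric monoidal functor -/

namespace Supply

open Functor.LaxMonoidal Functor.OplaxMonoidal

variable {P : Type u} [Category.{v} P] [MonoidalCategory P] [SymmetricCategory P] [PROP P]
  {C : Type u₁} [Category.{v₁} C] [MonoidalCategory C] [SymmetricCategory C]
  {D : Type u₂} [Category.{v₂} D] [MonoidalCategory D] [SymmetricCategory D]
  (s : Supply P C) (F : D ⥤ C) [F.Braided]

theorem map_id (c : C) (p : P) : s.map c (𝟙 p) = 𝟙 _ := by
  simp [Supply.map]

theorem map_comp (c : C) {p q r : P} (μ : p ⟶ q) (ν : q ⟶ r) :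
    s.map c (μ ≫ ν) = s.map c μ ≫ s.map c ν := by
  simp [Supply.map]

variable {s F} in
-- Preservation depends only on the maps between literal tensor powers, so the transports along
-- `obj_eq` can be dropped.
theorem preservesSupply_of_map {t : Supply P D} (h : ∀ (d : D) {p q : P} (μ : p ⟶ q),
    (tpowStrongator F d (PROP.size p)).hom ≫ F.map (t.map d μ) =
      s.map (F.obj d) μ ≫ (tpowStrongator F d (PROP.size q)).hom) :
    PreservesSupply F t s := fun d =>
  ⟨NatIso.ofComponents
    (fun p => eqToIso (s.obj_eq (F.obj d) p) ≪≫ tpowStrongator F d (PROP.size p) ≪≫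
      F.mapIso (eqToIso (t.obj_eq d p).symm))
    (fun {p q} μ => by
      have e₁ : (s.functor (F.obj d)).map μ = eqToHom (s.obj_eq (F.obj d) p) ≫
          s.map (F.obj d) μ ≫ eqToHom (s.obj_eq (F.obj d) q).symm := by simp [Supply.map]
      have e₂ : (t.functor d).map μ = eqToHom (t.obj_eq d p) ≫
          t.map d μ ≫ eqToHom (t.obj_eq d q).symm := by simp [Supply.map]
      simp only [Iso.trans_hom, eqToIso.hom, Functor.mapIso_hom, Functor.comp_map, e₁, e₂,
        F.map_comp, eqToHom_map, Category.assoc, eqToHom_trans_assoc, eqToHom_refl,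
        Category.id_comp]
      rw [← reassoc_of% h d μ]), fun p => rfl⟩

variable [F.Full]

/-- The morphism of `D` that `F` sends to `s_{F(d)}(μ)`, up to the strongators of `F`. -/
noncomputable def pullbackMap (d : D) {p q : P} (μ : p ⟶ q) :
    tpow d (PROP.size p) ⟶ tpow d (PROP.size q) :=
  F.preimage ((tpowStrongator F d (PROP.size p)).inv ≫ s.map (F.obj d) μ ≫
    (tpowStrongator F d (PROP.size q)).hom)

theorem map_pullbackMap (d : D) {p q : P} (μ : p ⟶ q) :
    F.map (s.pullbackMap F d μ) = (tpowStrongator F d (PROP.size p)).inv ≫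
      s.map (F.obj d) μ ≫ (tpowStrongator F d (PROP.size q)).hom :=
  F.map_preimage _

theorem strongator_map_pullbackMap (d : D) {p q : P} (μ : p ⟶ q) :
    (tpowStrongator F d (PROP.size p)).hom ≫ F.map (s.pullbackMap F d μ) =
      s.map (F.obj d) μ ≫ (tpowStrongator F d (PROP.size q)).hom := by
  rw [map_pullbackMap, Iso.hom_inv_id_assoc]

variable [F.Faithful]

variable {F} in
theorem pullbackMap_sigmaPair {c d : D} (hμ : s.IsNatural (Functor.Monoidal.μIso F c d))
    {p q : P} (μ : p ⟶ q) :
    (s.pullbackMap F c μ ⊗ₘ s.pullbackMap F d μ) ≫ (sigmaPair c d (PROP.size q)).hom =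
      (sigmaPair c d (PROP.size p)).hom ≫ s.pullbackMap F (c ⊗ d) μ := by
  apply F.map_injective
  rw [← cancel_epi (Functor.LaxMonoidal.μ F _ _),
    ← cancel_epi ((tpowStrongator F c (PROP.size p)).hom ⊗ₘ
      (tpowStrongator F d (PROP.size p)).hom), F.map_comp, F.map_comp,
    ← Functor.LaxMonoidal.μ_natural_assoc, reassoc_of% tpowStrongator_sigmaPair,
    tensorHom_comp_tensorHom_assoc, strongator_map_pullbackMap, strongator_map_pullbackMap,
    strongator_map_pullbackMap, reassoc_of% hμ μ, ← reassoc_of% map_sigmaPair,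
    ← tpowStrongator_sigmaPair, tensorHom_comp_tensorHom_assoc]

variable {F} in
theorem sigmaUnit_pullbackMap (hε : s.IsNatural (Functor.Monoidal.εIso F)) {p q : P} (μ : p ⟶ q) :
    (sigmaUnit (PROP.size p)).hom ≫ s.pullbackMap F (𝟙_ D) μ = (sigmaUnit (PROP.size q)).hom := by
  apply F.map_injective
  rw [← cancel_epi (ε F), F.map_comp, reassoc_of% tpowStrongator_sigmaUnit,
    strongator_map_pullbackMap, reassoc_of% hε μ, tpowStrongator_sigmaUnit,
    reassoc_of% sigmaUnit_map]

/-- The functor `P ⥤ D` given by the tensor powers of `d` and the morphisms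
`Supply.pullbackMap`. -/
noncomputable def pullbackFunctor (d : D) : P ⥤ D where
  obj p := tpow d (PROP.size p)
  map μ := s.pullbackMap F d μ
  map_id p := by
    apply F.map_injective
    simp [map_pullbackMap, map_id]
  map_comp μ ν := by
    apply F.map_injective
    simp [map_pullbackMap, map_comp]

/-- The strongators of `F` form an isomorphism between `s.pullbackFunctor F d ⋙ F` and
`s_{F(d)}`. -/
noncomputable def pullbackFunctorIso (d : D) :
    s.pullbackFunctor F d ⋙ F ≅ s.functor (F.obj d) :=
  NatIso.ofComponents
    (fun p => (tpowStrongator F d (PROP.size p)).symm ≪≫ eqToIso (s.obj_eq (F.obj d) p).symm)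
    (fun {p q} μ => by
      change F.map (s.pullbackMap F d μ) ≫ (tpowStrongator F d (PROP.size q)).inv ≫
          eqToHom (s.obj_eq _ q).symm =
        ((tpowStrongator F d (PROP.size p)).inv ≫ eqToHom (s.obj_eq _ p).symm) ≫ _
      rw [map_pullbackMap]
      simp [Supply.map])

/-- The monoidal structure on `s.pullbackFunctor F d` inherited from `s_{F(d)}`. -/
noncomputable abbrev pullbackFunctorMonoidal (d : D) : (s.pullbackFunctor F d).Monoidal :=
  letI := s.braided (F.obj d)
  letI : (s.pullbackFunctor F d ⋙ F).Monoidal :=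
    Functor.Monoidal.transport (s.pullbackFunctorIso F d).symm
  (Functor.coreMonoidalOfComp (s.pullbackFunctor F d) F).toMonoidal

theorem map_pullbackFunctor_μ (d : D) (p q : P) :
    letI := s.braided (F.obj d)
    letI := s.pullbackFunctorMonoidal F d
    F.map (μ (s.pullbackFunctor F d) p q) = δ F _ _ ≫
      ((s.pullbackFunctorIso F d).hom.app p ⊗ₘ (s.pullbackFunctorIso F d).hom.app q) ≫
        μ (s.functor (F.obj d)) p q ≫ (s.pullbackFunctorIso F d).inv.app (p ⊗ q) :=
  F.map_preimage _

/-- The functor `s.pullbackFunctor F d` is symmetric monoidal. -/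
noncomputable abbrev pullbackFunctorBraided (d : D) : (s.pullbackFunctor F d).Braided where
  __ := s.pullbackFunctorMonoidal F d
  braided p q := by
    let := s.braided (F.obj d)
    let := s.pullbackFunctorMonoidal F d
    apply F.map_injective
    rw [F.map_comp, F.map_comp, map_pullbackFunctor_μ, map_pullbackFunctor_μ]
    -- Moves the image of the braiding across the isomorphism to `s_{F(d)}`, which is braided; `F`
    -- being braided settles the rest.
    have h := (s.pullbackFunctorIso F d).inv.naturality (β_ p q).hom
    dsimp only [Functor.comp_map] at h
    simp only [Category.assoc]
    rw [← h, Functor.LaxBraided.braided_assoc, BraidedCategory.braiding_naturality_assoc,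
      Functor.map_braiding]
    simp

/-- The strongator was obtained as an abstract preimage. Faithfulness of `F` and
`tpowStrongator_tpowAdd` identify it with the coherence isomorphism. -/
theorem pullbackFunctor_μ (d : D) (p q : P) :
    letI := s.pullbackFunctorMonoidal F d
    μ (s.pullbackFunctor F d) p q = (tpowAdd d (PROP.size p) (PROP.size q)).hom ≫
      eqToHom (congrArg (tpow d) (PROP.size_tensor p q).symm) := by
  let := s.braided (F.obj d)
  apply F.map_injective
  rw [map_pullbackFunctor_μ, s.strongator_eq]
  change δ F (tpow d (PROP.size p)) (tpow d (PROP.size q)) ≫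
    (((tpowStrongator F d (PROP.size p)).inv ≫ eqToHom (s.obj_eq _ p).symm) ⊗ₘ
      ((tpowStrongator F d (PROP.size q)).inv ≫ eqToHom (s.obj_eq _ q).symm)) ≫
      ((eqToHom _ ⊗ₘ eqToHom _) ≫ (tpowAdd (F.obj d) _ _).hom ≫ eqToHom _) ≫
        eqToHom (s.obj_eq _ _) ≫ (tpowStrongator F d (PROP.size (p ⊗ q))).hom =
    F.map (X := tpow d (PROP.size p) ⊗ tpow d (PROP.size q)) (Y := tpow d (PROP.size (p ⊗ q)))
      ((tpowAdd d (PROP.size p) (PROP.size q)).hom ≫ eqToHom _)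
  rw [← cancel_epi (μ F _ _), ← cancel_epi ((tpowStrongator F d (PROP.size p)).hom ⊗ₘ
      (tpowStrongator F d (PROP.size q)).hom), F.map_comp,
    reassoc_of% tpowStrongator_tpowAdd,
    tpowStrongator_eqToHom F d (PROP.size_tensor p q).symm]
  simp

/-- The supply in `D` obtained from a supply in `C` along a fully faithful symmetric monoidal
functor `F : D ⥤ C` whose strongators are compatible with the supply in `C`. -/
noncomputable def pullback (hε : s.IsNatural (Functor.Monoidal.εIso F))
    (hμ : ∀ X Y, s.IsNatural (Functor.Monoidal.μIso F X Y)) : Supply P D where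
  functor := s.pullbackFunctor F
  braided := s.pullbackFunctorBraided F
  obj_eq _ _ := rfl
  strongator_eq d p q := by
    refine (s.pullbackFunctor_μ F d p q).trans ?_
    -- The equality `obj_eq` is `rfl` here, so the transports are identities by definition.
    change _ = (𝟙 _ ⊗ₘ 𝟙 _) ≫ _
    rw [id_tensorHom_id]
    exact (Category.id_comp _).symm
  map_tensor c d p q μ := by
    change ((𝟙 _ ≫ s.pullbackMap F c μ ≫ 𝟙 _) ⊗ₘ (𝟙 _ ≫ s.pullbackMap F d μ ≫ 𝟙 _)) ≫ _ =
      _ ≫ 𝟙 _ ≫ s.pullbackMap F (c ⊗ d) μ ≫ 𝟙 _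
    simp only [Category.id_comp, Category.comp_id]
    exact s.pullbackMap_sigmaPair (hμ c d) μ
  map_unit μ := by
    change _ = _ ≫ 𝟙 _ ≫ s.pullbackMap F (𝟙_ D) μ ≫ 𝟙 _
    simp only [Category.id_comp, Category.comp_id]
    exact (s.sigmaUnit_pullbackMap hε μ).symm

theorem pullback_map (hε : s.IsNatural (Functor.Monoidal.εIso F))
    (hμ : ∀ X Y, s.IsNatural (Functor.Monoidal.μIso F X Y)) (d : D) {p q : P} (μ : p ⟶ q) :
    (s.pullback F hε hμ).map d μ = s.pullbackMap F d μ := by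
  change 𝟙 _ ≫ s.pullbackMap F d μ ≫ 𝟙 _ = _
  simp only [Category.id_comp, Category.comp_id]

end Supply

/-! ### The pulled-back supply on the strictification and the explicit formula -/

namespace Strictification

variable {P : Type u} [Category.{v} P] [MonoidalCategory P] [SymmetricCategory P] [PROP P]
  {C : Type u₁} [Category.{v₁} C] [MonoidalCategory C]

theorem appendIso_single_hom (w : Word C) (c : C) :
    (Word.appendIso w (Word.single c)).hom = (Word.snocIso w c).hom := by
  change (w.tensor ◁ (λ_ c).inv) ≫ (α_ w.tensor (𝟙_ C) c).inv ≫ ((ρ_ w.tensor).hom ▷ c) ≫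
    (Word.snocIso w c).hom = _
  simp

theorem eqToHom_whiskerRight_snocIso {w w' : Word C} (h : w = w') (c : C) :
    (eqToHom (congrArg Word.tensor h) ▷ c) ≫ (Word.snocIso w' c).hom =
      (Word.snocIso w c).hom ≫ eqToHom (congrArg (fun z => (Word.snoc z c).tensor) h) := by
  subst h
  simp

/-- Appending one entry to a nonempty list is strict for left-bracketed products, so no coherence
isomorphism survives. The exponent `1` is separate: there a left unitor occurs, and it cancels by
left unitality of `⨂`. -/
theorem tpowStrongator_single (c : C) : ∀ n : ℕ,
    (tpowStrongator (bigTensor C) (single c) n).hom =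
      eqToHom (congrArg (bigTensor C).obj (tpow_single c n).symm)
  | 0 => rfl
  | 1 => (Iso.inv_comp_eq (λ_ ((bigTensor C).obj (single c)))).mpr <|
      (Functor.LaxMonoidal.left_unitality (bigTensor C) (single c)).symm.trans
        (Category.comp_id _).symm
  | n + 2 => by
      have ih := tpowStrongator_single c (n + 1)
      have h := eqToHom_whiskerRight_snocIso (tpow_single c (n + 1)).symm c
      change 𝟙 _ ≫ ((tpowStrongator (bigTensor C) (single c) (n + 1)).hom ▷ c) ≫
        (Word.appendIso (tpow (single c) (n + 1)).word (Word.single c)).hom ≫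
          𝟙 _ = _
      rw [ih, appendIso_single_hom, Category.id_comp]
      refine (congrArg _ (Category.comp_id _)).trans (h.trans (Category.id_comp _))

variable [SymmetricCategory C] (s : Supply P C)

theorem strictSingle_eq_pullbackMap (c : C) {p q : P} (μ : p ⟶ q) :
    s.strictSingle c μ = s.pullbackMap (bigTensor C) (single c) μ := by
  apply (bigTensor C).map_injective
  rw [Supply.map_pullbackMap, Iso.eq_inv_comp, tpowStrongator_single, tpowStrongator_single,
    Supply.strictSingle, Functor.map_comp, Functor.map_comp, eqToHom_map, eqToHom_map]
  exact (eqToHom_trans_assoc _ _ _).trans (Category.id_comp _)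

theorem isNatural_bigTensor_εIso : s.IsNatural (Functor.Monoidal.εIso (bigTensor C)) :=
  Supply.isNatural_refl (𝟙_ C)

theorem isNatural_bigTensor_μIso (X Y : Strictification C) :
    s.IsNatural (Functor.Monoidal.μIso (bigTensor C) X Y) :=
  Supply.isNatural_appendIso X.word Y.word

/-- The supply in the strictification induced by `s`. -/
noncomputable def supply : Supply P (Strictification C) :=
  s.pullback (bigTensor C) (isNatural_bigTensor_εIso s) (isNatural_bigTensor_μIso s)

theorem supply_map (L : Strictification C) {p q : P} (μ : p ⟶ q) :
    (supply s).map L μ = s.pullbackMap (bigTensor C) L μ :=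
  s.pullback_map _ _ _ L μ

theorem strictMap_eq_pullbackMap (L : Strictification C) {p q : P} (μ : p ⟶ q) :
    s.strictMap L μ = s.pullbackMap (bigTensor C) L μ := by
  have h : (fun c => s.strictSingle c μ) = fun c => (supply s).map (single c) μ := by
    funext c
    rw [supply_map, strictSingle_eq_pullbackMap]
  -- The pullback is already known to be a supply in the strictification, so `tensorMap_sigmaWord`
  -- applies to it and no `σ` has to be computed in `C`.
  rw [← supply_map, Supply.strictMap, h, reassoc_of% (supply s).tensorMap_sigmaWord,
    Iso.inv_hom_id_assoc]
  exact ((supply s).map_eqToHom (tensor_single L.word) μ).symm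

end Strictification

theorem mainTheorem4
    {P : Type u} [Category.{v} P] [MonoidalCategory P] [SymmetricCategory P] [PROP P]
    {C : Type u₁} [Category.{v₁} C] [MonoidalCategory C] [SymmetricCategory C]
    (s : Supply P C) :
    (∃ t : Supply P (Strictification C), IsInducedSupply s t) ∧
      ∀ t : Supply P (Strictification C), IsInducedSupply s t →
        PreservesSupply (bigTensor C) t s := by
  refine ⟨⟨Strictification.supply s, fun L p q μ => ?_⟩,
    fun t ht => Supply.preservesSupply_of_map fun L p q μ => ?_⟩
  · rw [Strictification.supply_map, Strictification.strictMap_eq_pullbackMap]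
  -- Any induced supply has the same maps as the pullback, so preservation holds for it whatever its
  -- remaining data.
  · rw [ht L μ, Strictification.strictMap_eq_pullbackMap, Supply.strongator_map_pullbackMap]
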